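/- Manifolds are smooth, finite-dimensional, Hausdorff, second countable and without boundary; a Lie groupoid has surjective submersions as source and target. Let $(G,H,\tau,\alpha)$ be a Lie crossed module, and let $\mathbb G=[H\rtimes_\alpha G\rightrightarrows G]$ be its Lie $2$-group: $s(h,g)=g$, $t(h,g)=\tau(h)g$, $1_g=(e,g)$, $(h_2,g_2)\circ(h_1,g_1)=(h_2h_1,g_1)$, with group law $(h_2,g_2)(h_1,g_1)=(h_2\,\alpha(g_2,h_1),g_2g_1)$. Write $\tau=\tau_{*,e}\colon L(H)\to L(G)$ and $\alpha_g=\alpha(g,\cdot)_{*,e}\colon L(H)\to L(H)$ also for the differentials. Let $L(\mathbb G)=[L(H)\oplus L(G)\rightrightarrows L(G)]$ be the associated Lie groupoid: $s(A,B)=B$, $t(A,B)=\tau(A)+B$, $1_B=(0,B)$, $(A_2,B_2)\circ(A_1,B_1)=(A_2+A_1,B_1)$. For $k$ in $G$ or in $H\rtimes_\alpha G$, let $\mathrm{ad}_k$ be the adjoint action on its Lie algebra. Let $\pi\colon\mathbb E=[E_1\rightrightarrows E_0]\to\mathbb X=[X_1\rightrightarrows X_0]$ be a principal $\mathbb G$-bundle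 over a Lie groupoid: $\pi=(\pi_1,\pi_0)$ is a morphism of Lie groupoids, and there is a morphism of Lie groupoids $\mathbb E\times\mathbb G\to\mathbb E$, given on objects and on arrows by right Lie group actions, that makes $\pi_0\colon E_0\to X_0$ a principal $G$-bundle and $\pi_1\colon E_1\to X_1$ a principal $H\rtimes_\alpha G$-bundle. Let $T\mathbb E=[TE_1\rightrightarrows TE_0]$ be the tangent Lie groupoid, whose structure maps are the differentials of those of $\mathbb E$, and let $\delta\colon\mathbb E\times L(\mathbb G)\to T\mathbb E$ be the functor given on objects and on arrows by the fundamental vector fields: $\delta_x(B)$ is the image of $B$ under the differential at the identity of $k\mapsto xk$. A *$\mathbb G$-equivariant $L(\mathbb G)$-valued $1$-form* on $\mathbb E$ is a pair $\omega=(\omega_0,\omega_1)$, where $\omega_0$ is a smooth $L(G)$-valued $1$-form on $E_0$ and $\omega_1$ is a smooth $L(H)\oplus L(G)$-valued $1$-form on $E_1$, such that $\omega\colon T\mathbb E\to L(\mathbb G)$ is a functor and $\omega_i(v\cdot k)=\mathrm{ad}_{k^{-1}}(\omega_i(v))$ for $i\in\{0,1\}$. It is a *strict connection $1$-form* if $\omega\circ\delta=\mathrm{pr}_2\colon\mathbb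 E\times L(\mathbb G)\to L(\mathbb G)$. It is a *semi-strict connection $1$-form* if there is a natural isomorphism $\kappa\colon\omega\circ\delta\Rightarrow\mathrm{pr}_2$ such that the map $\kappa\colon E_0\times L(G)\to L(H)\oplus L(G)$ is smooth, linear in the second variable, and equivariant: $\kappa(pg,\mathrm{ad}_{g^{-1}}B)=\mathrm{ad}_{1_g^{-1}}\kappa(p,B)$. **Statement.** Let $\omega=(\omega_0,\omega_1)$ be a strict connection $1$-form on such a bundle, and let $\lambda$ be a smooth $L(H)$-valued $1$-form on $E_0$ with $\lambda(pg,v\cdot g)=\alpha_{g^{-1}}(\lambda(p,v))$ for all $p\in E_0$, $v\in T_pE_0$, $g\in G$. Then $$\widetilde\omega_0=\omega_0+\tau(\lambda),\qquad \widetilde\omega_1=\omega_1+\tau(s^*\lambda)+t^*\lambda-s^*\lambda$$ form a semi-strict connection $1$-form $\widetilde\omega=(\widetilde\omega_0,\widetilde\omega_1)$. Here $s,t\colon E_1\to E_0$ are the source and target maps of $\mathbb E$, and in $\widetilde\omega_1$ the term $\tau(s^*\lambda)$ lies in the summand $L(G)$ and $t^*\lambda-s^*\lambda$ in the summand $L(H)$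 of $L(H)\oplus L(G)$. -/

import Mathlib

open scoped Manifold ContDiff

/-! ### Groupoids, functors and natural transformations

The composite `comp b a` of two arrows is written in the order `b ∘ a`; it is meaningful when
`src b = tgt a`, and only its values on such composable pairs are ever used. -/

/-- The structure maps of a groupoid with arrows `A₁` and objects `A₀`. -/
structure GroupoidOps (A₁ A₀ : Type*) where
  src : A₁ → A₀
  tgt : A₁ → A₀
  unit : A₀ → A₁
  inv : A₁ → A₁
  comp : A₁ → A₁ → A₁

namespace GroupoidOps

/-- The set of composable pairs `(b, a)`, i.e. the fibre product of `src` and `tgt`. -/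
def composable {A₁ A₀ : Type*} (A : GroupoidOps A₁ A₀) : Set (A₁ × A₁) :=
  {c | A.src c.1 = A.tgt c.2}

/-- The groupoid axioms. -/
structure IsGroupoid {A₁ A₀ : Type*} (A : GroupoidOps A₁ A₀) : Prop where
  src_unit : ∀ x, A.src (A.unit x) = x
  tgt_unit : ∀ x, A.tgt (A.unit x) = x
  src_inv : ∀ a, A.src (A.inv a) = A.tgt a
  tgt_inv : ∀ a, A.tgt (A.inv a) = A.src a
  src_comp : ∀ b a, A.src b = A.tgt a → A.src (A.comp b a) = A.src a
  tgt_comp : ∀ b a, A.src b = A.tgt a → A.tgt (A.comp b a) = A.tgt b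
  assoc : ∀ c b a, A.src c = A.tgt b → A.src b = A.tgt a →
    A.comp (A.comp c b) a = A.comp c (A.comp b a)
  comp_unit : ∀ a, A.comp a (A.unit (A.src a)) = a
  unit_comp : ∀ a, A.comp (A.unit (A.tgt a)) a = a
  inv_comp : ∀ a, A.comp (A.inv a) a = A.unit (A.src a)
  comp_inv : ∀ a, A.comp a (A.inv a) = A.unit (A.tgt a)

/-- The product groupoid. -/
def prod {A₁ A₀ B₁ B₀ : Type*} (A : GroupoidOps A₁ A₀) (B : GroupoidOps B₁ B₀) :
    GroupoidOps (A₁ × B₁) (A₀ × B₀) where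
  src c := (A.src c.1, B.src c.2)
  tgt c := (A.tgt c.1, B.tgt c.2)
  unit x := (A.unit x.1, B.unit x.2)
  inv c := (A.inv c.1, B.inv c.2)
  comp c d := (A.comp c.1 d.1, B.comp c.2 d.2)

/-- `(F₁, F₀)` is a functor from `A` to `B`. -/
structure IsFunctor {A₁ A₀ B₁ B₀ : Type*} (A : GroupoidOps A₁ A₀) (B : GroupoidOps B₁ B₀)
    (F₁ : A₁ → B₁) (F₀ : A₀ → B₀) : Prop where
  map_src : ∀ a, B.src (F₁ a) = F₀ (A.src a)
  map_tgt : ∀ a, B.tgt (F₁ a) = F₀ (A.tgt a)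
  map_unit : ∀ x, F₁ (A.unit x) = B.unit (F₀ x)
  map_comp : ∀ b a, A.src b = A.tgt a → F₁ (A.comp b a) = B.comp (F₁ b) (F₁ a)

/-- `κ` is a natural transformation from the functor `(F₁, F₀)` to the functor `(F₁', F₀')`,
with components `κ x : F₀ x ⟶ F₀' x`. When `B` is a groupoid it is a natural isomorphism. -/
structure IsNatTrans {A₁ A₀ B₁ B₀ : Type*} (A : GroupoidOps A₁ A₀) (B : GroupoidOps B₁ B₀)
    (F₁ : A₁ → B₁) (F₀ : A₀ → B₀) (F₁' : A₁ → B₁) (F₀' : A₀ → B₀) (κ : A₀ → B₁) : Prop where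
  src_app : ∀ x, B.src (κ x) = F₀ x
  tgt_app : ∀ x, B.tgt (κ x) = F₀' x
  naturality : ∀ a, B.comp (κ (A.tgt a)) (F₁ a) = B.comp (F₁' a) (κ (A.src a))

end GroupoidOps

/-! ### Lie groupoids and their tangent groupoids -/

section LieGroupoid

variable {V₁ W₁ V₀ W₀ : Type*} [NormedAddCommGroup V₁] [NormedSpace ℝ V₁] [TopologicalSpace W₁]
  [NormedAddCommGroup V₀] [NormedSpace ℝ V₀] [TopologicalSpace W₀]
  (I₁ : ModelWithCorners ℝ V₁ W₁) (M₁ : Type*) [TopologicalSpace M₁] [ChartedSpace W₁ M₁]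
  (I₀ : ModelWithCorners ℝ V₀ W₀) (M₀ : Type*) [TopologicalSpace M₀] [ChartedSpace W₀ M₀]

/-- A Lie groupoid `[M₁ ⇉ M₀]`: a groupoid with smooth structure maps whose source and target are
surjective submersions. The composition is smooth on the fibre product of composable pairs, an
embedded submanifold of `M₁ × M₁`. -/
structure LieGroupoid extends GroupoidOps M₁ M₀ where
  isGroupoid : toGroupoidOps.IsGroupoid
  smooth_src : ContMDiff I₁ I₀ ∞ src
  smooth_tgt : ContMDiff I₁ I₀ ∞ tgt
  smooth_unit : ContMDiff I₀ I₁ ∞ unit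
  smooth_inv : ContMDiff I₁ I₁ ∞ inv
  smooth_comp : ContMDiffOn (I₁.prod I₁) I₁ ∞ (fun c : M₁ × M₁ => comp c.1 c.2)
    toGroupoidOps.composable
  submersion_src : Manifold.IsSubmersion I₁ I₀ ∞ src
  submersion_tgt : Manifold.IsSubmersion I₁ I₀ ∞ tgt
  surjective_src : Function.Surjective src
  surjective_tgt : Function.Surjective tgt

variable {M₁ M₀}

/-- The tangent groupoid `[TM₁ ⇉ TM₀]` of `[M₁ ⇉ M₀]`: its structure maps are the differentials of
the structure maps. For the composition this is the differential of `m : M₁ ×_{M₀} M₁ → M₁`, i.e.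
the derivative of `m` within the fibre product; `(b, a)` is composable for the tangent groupoid
exactly when it is tangent to the fibre product, and on such pairs the derivative is unique. -/
noncomputable def GroupoidOps.tangent (A : GroupoidOps M₁ M₀) :
    GroupoidOps (TangentBundle I₁ M₁) (TangentBundle I₀ M₀) where
  src := tangentMap I₁ I₀ A.src
  tgt := tangentMap I₁ I₀ A.tgt
  unit := tangentMap I₀ I₁ A.unit
  inv := tangentMap I₁ I₁ A.inv
  comp b a := tangentMapWithin (I₁.prod I₁) I₁ (fun c : M₁ × M₁ => A.comp c.1 c.2) A.composable
    ((equivTangentBundleProd I₁ M₁ I₁ M₁).symm (b, a))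

end LieGroupoid

/-! ### Lie algebras, right actions, principal bundles, one-forms -/

section Actions

variable {VG WG : Type*} [NormedAddCommGroup VG] [NormedSpace ℝ VG] [TopologicalSpace WG]
  (IG : ModelWithCorners ℝ VG WG) {G : Type*} [TopologicalSpace G] [ChartedSpace WG G] [Group G]
  {VP WP : Type*} [NormedAddCommGroup VP] [NormedSpace ℝ VP] [TopologicalSpace WP]
  (IP : ModelWithCorners ℝ VP WP) {P : Type*} [TopologicalSpace P] [ChartedSpace WP P]
  {VM WM : Type*} [NormedAddCommGroup VM] [NormedSpace ℝ VM] [TopologicalSpace WM]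
  (IM : ModelWithCorners ℝ VM WM) {M : Type*} [TopologicalSpace M] [ChartedSpace WM M]

variable (G) in
/-- The vector space underlying the Lie algebra `L(G) = T_1 G`. In Mathlib `T_1 G` is by definition
the vector space on which `G` is modelled (see `lieAlg_eq`); unlike `GroupLieAlgebra IG G` this
version carries the norm of that vector space, so that one can speak of smooth maps into it. -/
@[nolint unusedArguments]
abbrev LieAlg (_ : ModelWithCorners ℝ VG WG) (G : Type*) [TopologicalSpace G] [ChartedSpace WG G]
    [Group G] : Type _ := VG

theorem lieAlg_eq : LieAlg IG G = GroupLieAlgebra IG G := rfl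

/-- The adjoint action of `g : G` on `L(G)`: the differential at `1` of `x ↦ g x g⁻¹`. -/
noncomputable def adjoint (g : G) (B : LieAlg IG G) : LieAlg IG G :=
  mfderiv IG IG (fun x : G => g * x * g⁻¹) 1 B

/-- `act` is a smooth right action of the Lie group `G` on `P`. -/
structure IsSmoothRightAction (act : P → G → P) : Prop where
  smooth : ContMDiff (IP.prod IG) IP ∞ (fun c : P × G => act c.1 c.2)
  act_one : ∀ p, act p 1 = p
  act_mul : ∀ p g h, act p (g * h) = act (act p g) h

/-- `proj : P → M` with the right action `act` is a principal `G`-bundle: around each point of `M`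
there is a `G`-equivariant smooth trivialization. -/
structure IsPrincipalBundle (proj : P → M) (act : P → G → P) : Prop
    extends IsSmoothRightAction IG IP act where
  smooth_proj : ContMDiff IP IM ∞ proj
  proj_act : ∀ p g, proj (act p g) = proj p
  locally_trivial : ∀ x : M, ∃ U : Set M, IsOpen U ∧ x ∈ U ∧
    ∃ φ : OpenPartialHomeomorph P (M × G),
      φ.source = proj ⁻¹' U ∧ φ.target = U ×ˢ Set.univ ∧
      ContMDiffOn IP (IM.prod IG) ∞ φ φ.source ∧
      ContMDiffOn (IM.prod IG) IP ∞ φ.symm φ.target ∧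
      ∀ p ∈ φ.source, (φ p).1 = proj p ∧ ∀ g, φ (act p g) = (proj p, (φ p).2 * g)

/-- The action `v ↦ v · g` of `g : G` on the tangent bundle: the differential of `p ↦ p g`. -/
noncomputable def tangentAct (act : P → G → P) (v : TangentBundle IP P) (g : G) :
    TangentBundle IP P :=
  tangentMap IP IP (fun p => act p g) v

/-- The value `δ_p(B)` at `p` of the fundamental vector field of `B ∈ L(G)`: the image of
`B ∈ T_1 G` under the differential of `g ↦ p g` (a tangent vector at the point `p 1 = p`). -/
noncomputable def fundamental (act : P → G → P) (c : P × LieAlg IG G) : TangentBundle IP P :=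
  tangentMap IG IP (fun g : G => act c.1 g) ⟨1, c.2⟩

/-- A smooth `V`-valued differential one-form on `P`, as a fibrewise linear map `TP → V`. -/
structure IsOneForm [IsManifold IP ∞ P] {V : Type*} [NormedAddCommGroup V] [NormedSpace ℝ V]
    (η : TangentBundle IP P → V) : Prop where
  smooth : ContMDiff IP.tangent 𝓘(ℝ, V) ∞ η
  linear : ∀ p : P, IsLinearMap ℝ (fun v : TangentSpace IP p => η ⟨p, v⟩)

end Actions

/-! ### Lie crossed modules, their Lie 2-groups and Lie 2-algebras -/

section CrossedModule

variable {VG WG : Type*} [NormedAddCommGroup VG] [NormedSpace ℝ VG] [TopologicalSpace WG]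
  (IG : ModelWithCorners ℝ VG WG) (G : Type*) [TopologicalSpace G] [ChartedSpace WG G] [Group G]
  {VH WH : Type*} [NormedAddCommGroup VH] [NormedSpace ℝ VH] [TopologicalSpace WH]
  (IH : ModelWithCorners ℝ VH WH) (H : Type*) [TopologicalSpace H] [ChartedSpace WH H] [Group H]

/-- A Lie crossed module `(G, H, τ, α)`. -/
structure LieCrossedModule where
  τ : H →* G
  α : G →* MulAut H
  smooth_τ : ContMDiff IH IG ∞ τ
  smooth_α : ContMDiff (IG.prod IH) IH ∞ (fun c : G × H => α c.1 c.2)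
  τ_α : ∀ g h, τ (α g h) = g * τ h * g⁻¹
  α_τ : ∀ h h', α (τ h) h' = h * h' * h⁻¹

end CrossedModule

namespace LieCrossedModule

variable {VG WG : Type*} [NormedAddCommGroup VG] [NormedSpace ℝ VG] [TopologicalSpace WG]
  {IG : ModelWithCorners ℝ VG WG} {G : Type*} [TopologicalSpace G] [ChartedSpace WG G] [Group G]
  {VH WH : Type*} [NormedAddCommGroup VH] [NormedSpace ℝ VH] [TopologicalSpace WH]
  {IH : ModelWithCorners ℝ VH WH} {H : Type*} [TopologicalSpace H] [ChartedSpace WH H] [Group H]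
  (C : LieCrossedModule IG G IH H)

/-- The manifold `H × G` underlying the group `H ⋊_α G` of arrows of the Lie 2-group of `C`. -/
@[nolint unusedArguments]
def Arrows (_ : LieCrossedModule IG G IH H) : Type _ := H × G

instance : TopologicalSpace C.Arrows := inferInstanceAs (TopologicalSpace (H × G))

instance : ChartedSpace (ModelProd WH WG) C.Arrows :=
  inferInstanceAs (ChartedSpace (ModelProd WH WG) (H × G))

/-- The arrow `(h, g)`. -/
def arrow (h : H) (g : G) : C.Arrows := (h, g)

/-- The `H`-component of an arrow `(h, g)`. -/
def fstH (k : C.Arrows) : H := Prod.fst (show H × G from k)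

/-- The `G`-component of an arrow `(h, g)`. -/
def sndG (k : C.Arrows) : G := Prod.snd (show H × G from k)

/-- The semidirect product group `H ⋊_α G`. -/
instance : Group C.Arrows where
  mul k l := C.arrow (C.fstH k * C.α (C.sndG k) (C.fstH l)) (C.sndG k * C.sndG l)
  one := C.arrow 1 1
  inv k := C.arrow (C.α (C.sndG k)⁻¹ (C.fstH k)⁻¹) (C.sndG k)⁻¹
  mul_assoc a b c := Prod.ext
    (show C.fstH a * C.α (C.sndG a) (C.fstH b) * C.α (C.sndG a * C.sndG b) (C.fstH c) =
      C.fstH a * C.α (C.sndG a) (C.fstH b * C.α (C.sndG b) (C.fstH c)) by simp [mul_assoc])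
    (mul_assoc (C.sndG a) _ _)
  one_mul a := Prod.ext (show 1 * C.α 1 (C.fstH a) = C.fstH a by simp) (one_mul (C.sndG a))
  mul_one a := Prod.ext (show C.fstH a * C.α (C.sndG a) 1 = C.fstH a by simp)
    (mul_one (C.sndG a))
  inv_mul_cancel a := Prod.ext
    (show C.α (C.sndG a)⁻¹ (C.fstH a)⁻¹ * C.α (C.sndG a)⁻¹ (C.fstH a) = 1 by
      rw [← map_mul]; simp)
    (inv_mul_cancel (C.sndG a))

instance [IsManifold IH ∞ H] [IsManifold IG ∞ G] : IsManifold (IH.prod IG) ∞ C.Arrows :=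
  inferInstanceAs (IsManifold (IH.prod IG) ∞ (H × G))

/-- `H ⋊_α G` is a Lie group. -/
instance [LieGroup IH ∞ H] [LieGroup IG ∞ G] : LieGroup (IH.prod IG) ∞ C.Arrows where
  contMDiff_mul := by
    have h₁ : ContMDiff ((IH.prod IG).prod (IH.prod IG)) (IH.prod IG) ∞
        (fun c : (H × G) × (H × G) =>
          ((c.1.1 * C.α c.1.2 c.2.1, c.1.2 * c.2.2) : H × G)) := by
      refine ContMDiff.prodMk (ContMDiff.mul (contMDiff_fst.comp contMDiff_fst) ?_)
        (ContMDiff.mul (contMDiff_snd.comp contMDiff_fst) (contMDiff_snd.comp contMDiff_snd))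
      exact C.smooth_α.comp
        (ContMDiff.prodMk (contMDiff_snd.comp contMDiff_fst) (contMDiff_fst.comp contMDiff_snd))
    exact h₁
  contMDiff_inv := by
    have h₁ : ContMDiff (IH.prod IG) (IH.prod IG) ∞
        (fun c : H × G => ((C.α c.2⁻¹ c.1⁻¹, c.2⁻¹) : H × G)) := by
      refine ContMDiff.prodMk ?_ (ContMDiff.inv contMDiff_snd)
      exact C.smooth_α.comp
        (ContMDiff.prodMk (ContMDiff.inv contMDiff_snd) (ContMDiff.inv contMDiff_fst))
    exact h₁

/-- The Lie 2-group `[H ⋊_α G ⇉ G]` of the crossed module, as a groupoid. -/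
def twoGroup : GroupoidOps C.Arrows G where
  src k := C.sndG k
  tgt k := C.τ (C.fstH k) * C.sndG k
  unit g := C.arrow 1 g
  inv k := C.arrow (C.fstH k)⁻¹ (C.τ (C.fstH k) * C.sndG k)
  comp l k := C.arrow (C.fstH l * C.fstH k) (C.sndG k)

/-- The differential `τ : L(H) → L(G)` of `τ` at the identity. -/
noncomputable def dτ (A : LieAlg IH H) : LieAlg IG G := mfderiv IH IG C.τ 1 A

/-- The differential `α_g : L(H) → L(H)` of `h ↦ α(g, h)` at the identity. -/
noncomputable def dα (g : G) (A : LieAlg IH H) : LieAlg IH H :=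
  mfderiv IH IH (fun h : H => C.α g h) 1 A

/-- The vector space `L(H ⋊ G) = L(H) ⊕ L(G)`. -/
abbrev LieArrows (_ : LieCrossedModule IG G IH H) : Type _ := LieAlg IH H × LieAlg IG G

theorem lieArrows_eq : C.LieArrows = LieAlg (IH.prod IG) C.Arrows := rfl

/-- The adjoint action of `H ⋊_α G` on its Lie algebra `L(H) ⊕ L(G)`. -/
noncomputable def adjointArrows (k : C.Arrows) (K : C.LieArrows) : C.LieArrows :=
  adjoint (IH.prod IG) k K

/-- The Lie 2-algebra `L(𝔾) = [L(H) ⊕ L(G) ⇉ L(G)]`, as a groupoid: its structure maps, the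
differentials at the identity of the structure maps of the Lie 2-group, written out. -/
noncomputable def lieTwoAlgebra : GroupoidOps C.LieArrows (LieAlg IG G) where
  src K := K.2
  tgt K := C.dτ K.1 + K.2
  unit B := (0, B)
  inv K := (-K.1, C.dτ K.1 + K.2)
  comp L K := (L.1 + K.1, K.2)

/-- In particular natural transformations of functors into `L(𝔾)` are natural isomorphisms. -/
theorem lieTwoAlgebra_isGroupoid : C.lieTwoAlgebra.IsGroupoid := by
  have hadd : ∀ A B, C.dτ (A + B) = C.dτ A + C.dτ B :=
    fun A B => map_add (mfderiv IH IG C.τ 1) A B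
  have hzero : C.dτ 0 = 0 := map_zero (mfderiv IH IG C.τ 1)
  have hneg : ∀ A, C.dτ (-A) = -C.dτ A := fun A => map_neg (mfderiv IH IG C.τ 1) A
  constructor <;> simp only [lieTwoAlgebra] <;> intros <;>
    simp_all [add_assoc]

end LieCrossedModule

/-! ### Principal 2-bundles and connection one-forms -/

section TwoBundle

variable
  {VG WG : Type*} [NormedAddCommGroup VG] [NormedSpace ℝ VG] [TopologicalSpace WG]
  {IG : ModelWithCorners ℝ VG WG} {G : Type*} [TopologicalSpace G] [ChartedSpace WG G] [Group G]
  {VH WH : Type*} [NormedAddCommGroup VH] [NormedSpace ℝ VH] [TopologicalSpace WH]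
  {IH : ModelWithCorners ℝ VH WH} {H : Type*} [TopologicalSpace H] [ChartedSpace WH H] [Group H]
  {VE₁ WE₁ : Type*} [NormedAddCommGroup VE₁] [NormedSpace ℝ VE₁] [TopologicalSpace WE₁]
  {IE₁ : ModelWithCorners ℝ VE₁ WE₁} {E₁ : Type*} [TopologicalSpace E₁] [ChartedSpace WE₁ E₁]
  {VE₀ WE₀ : Type*} [NormedAddCommGroup VE₀] [NormedSpace ℝ VE₀] [TopologicalSpace WE₀]
  {IE₀ : ModelWithCorners ℝ VE₀ WE₀} {E₀ : Type*} [TopologicalSpace E₀] [ChartedSpace WE₀ E₀]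
  {VX₁ WX₁ : Type*} [NormedAddCommGroup VX₁] [NormedSpace ℝ VX₁] [TopologicalSpace WX₁]
  {IX₁ : ModelWithCorners ℝ VX₁ WX₁} {X₁ : Type*} [TopologicalSpace X₁] [ChartedSpace WX₁ X₁]
  {VX₀ WX₀ : Type*} [NormedAddCommGroup VX₀] [NormedSpace ℝ VX₀] [TopologicalSpace WX₀]
  {IX₀ : ModelWithCorners ℝ VX₀ WX₀} {X₀ : Type*} [TopologicalSpace X₀] [ChartedSpace WX₀ X₀]

/-- A principal 2-bundle `π : 𝔼 → 𝕏` whose structure 2-group is the Lie 2-group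
`𝔾 = [H ⋊_α G ⇉ G]` of the crossed module `C`: a functor `π = (proj₁, proj₀)` and an action functor
`𝔼 × 𝔾 → 𝔼` such that `E₀ → X₀` is a principal `G`-bundle and `E₁ → X₁` is a principal
`H ⋊_α G`-bundle. -/
structure PrincipalTwoBundle (C : LieCrossedModule IG G IH H) (𝔼 : LieGroupoid IE₁ E₁ IE₀ E₀)
    (𝕏 : LieGroupoid IX₁ X₁ IX₀ X₀) where
  proj₁ : E₁ → X₁
  proj₀ : E₀ → X₀
  act₁ : E₁ → C.Arrows → E₁
  act₀ : E₀ → G → E₀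
  proj_functor : 𝔼.toGroupoidOps.IsFunctor 𝕏.toGroupoidOps proj₁ proj₀
  act_functor : (𝔼.toGroupoidOps.prod C.twoGroup).IsFunctor 𝔼.toGroupoidOps
    (fun c => act₁ c.1 c.2) (fun c => act₀ c.1 c.2)
  principal₁ : IsPrincipalBundle (IH.prod IG) IE₁ IX₁ proj₁ act₁
  principal₀ : IsPrincipalBundle IG IE₀ IX₀ proj₀ act₀

namespace PrincipalTwoBundle

variable {C : LieCrossedModule IG G IH H} {𝔼 : LieGroupoid IE₁ E₁ IE₀ E₀}
  {𝕏 : LieGroupoid IX₁ X₁ IX₀ X₀} (P : PrincipalTwoBundle C 𝔼 𝕏)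
  [IsManifold IE₁ ∞ E₁] [IsManifold IE₀ ∞ E₀]

/-- `ω = (ω₁, ω₀) : T𝔼 → L(𝔾)` is a `𝔾`-equivariant `L(𝔾)`-valued one-form. -/
structure IsEquivariantForm (ω₁ : TangentBundle IE₁ E₁ → C.LieArrows)
    (ω₀ : TangentBundle IE₀ E₀ → LieAlg IG G) : Prop where
  oneForm₁ : IsOneForm IE₁ ω₁
  oneForm₀ : IsOneForm IE₀ ω₀
  functor : (𝔼.toGroupoidOps.tangent IE₁ IE₀).IsFunctor C.lieTwoAlgebra ω₁ ω₀
  equivariant₁ : ∀ v k, ω₁ (tangentAct IE₁ P.act₁ v k) = C.adjointArrows k⁻¹ (ω₁ v)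
  equivariant₀ : ∀ v g, ω₀ (tangentAct IE₀ P.act₀ v g) = adjoint IG g⁻¹ (ω₀ v)

/-- The functor `δ : 𝔼 × L(𝔾) → T𝔼` on arrows. -/
noncomputable def δ₁ (c : E₁ × C.LieArrows) : TangentBundle IE₁ E₁ :=
  fundamental (IH.prod IG) IE₁ P.act₁ c

/-- The functor `δ : 𝔼 × L(𝔾) → T𝔼` on objects. -/
noncomputable def δ₀ (c : E₀ × LieAlg IG G) : TangentBundle IE₀ E₀ :=
  fundamental IG IE₀ P.act₀ c

/-- A strict connection one-form: `ω ∘ δ = pr₂`. -/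
structure IsStrictConnection (ω₁ : TangentBundle IE₁ E₁ → C.LieArrows)
    (ω₀ : TangentBundle IE₀ E₀ → LieAlg IG G) : Prop extends P.IsEquivariantForm ω₁ ω₀ where
  comp_δ₁ : ∀ c, ω₁ (P.δ₁ c) = c.2
  comp_δ₀ : ∀ c, ω₀ (P.δ₀ c) = c.2

/-- A semi-strict connection one-form: there is a smooth, fibrewise linear, `𝔾`-equivariant
natural isomorphism `κ : ω ∘ δ ⟹ pr₂` of functors `𝔼 × L(𝔾) → L(𝔾)`. -/
structure IsSemiStrictConnection (ω₁ : TangentBundle IE₁ E₁ → C.LieArrows)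
    (ω₀ : TangentBundle IE₀ E₀ → LieAlg IG G) : Prop extends P.IsEquivariantForm ω₁ ω₀ where
  exists_natIso : ∃ κ : E₀ × LieAlg IG G → C.LieArrows,
    ContMDiff (IE₀.prod 𝓘(ℝ, LieAlg IG G)) 𝓘(ℝ, C.LieArrows) ∞ κ ∧
    (∀ p, IsLinearMap ℝ (fun B => κ (p, B))) ∧
    (∀ p B g, κ (P.act₀ p g, adjoint IG g⁻¹ B) =
      C.adjointArrows (C.twoGroup.unit g)⁻¹ (κ (p, B))) ∧
    (𝔼.toGroupoidOps.prod C.lieTwoAlgebra).IsNatTrans C.lieTwoAlgebra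
      (fun c => ω₁ (P.δ₁ c)) (fun c => ω₀ (P.δ₀ c)) (fun c => c.2) (fun c => c.2) κ

end PrincipalTwoBundle

end TwoBundle

/-! ### Tangent maps, and local lifts through submersions -/

section TangentMap

variable {E₁ H₁ M₁ E₂ H₂ M₂ E₃ H₃ M₃ : Type*}
  [NormedAddCommGroup E₁] [NormedSpace ℝ E₁] [TopologicalSpace H₁] {I₁ : ModelWithCorners ℝ E₁ H₁}
  [TopologicalSpace M₁] [ChartedSpace H₁ M₁]
  [NormedAddCommGroup E₂] [NormedSpace ℝ E₂] [TopologicalSpace H₂] {I₂ : ModelWithCorners ℝ E₂ H₂}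
  [TopologicalSpace M₂] [ChartedSpace H₂ M₂]
  [NormedAddCommGroup E₃] [NormedSpace ℝ E₃] [TopologicalSpace H₃] {I₃ : ModelWithCorners ℝ E₃ H₃}
  [TopologicalSpace M₃] [ChartedSpace H₃ M₃]

/-! The correction added to `ω` is the pair with object part `τ(λ)` and arrow part `(t*λ - s*λ,
τ(s*λ))`. It is itself an equivariant functor `T𝔼 → L(𝔾)`: its source and target are `τ(s*λ)` and
`τ(t*λ)`, its `L(H)` part vanishes on units and telescopes along composites. Since the structure
maps of `L(𝔾)` are additive, adding it to `ω` gives a functor again (`gauge_functor`).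

The delicate point is composition in `T𝔼`, a derivative within the set of composable pairs. One
needs `Ts(b ∘ a) = Ts(a)` and `Tt(b ∘ a) = Tt(b)`. As the source is a submersion, a differentiable
map `T` sends a neighbourhood of a composable pair into the composable pairs, and its differential
fixes the given tangent pair (`exists_local_retraction`). The tangent composite is then an ordinary
derivative of `comp ∘ T`, and the identities follow from those of the groupoid.

For equivariance, write `(X - Y, τY) = (X, 0) + (-Y, τY)` with `X = t*λ` and `Y = s*λ`. The summands
are tangent to the kernels of source and target of the 2-group, on which `ad` of `k⁻¹` acts through
`t(k)⁻¹` and `s(k)⁻¹` respectively (`adjointArrows_inv_fst`, `adjointArrows_inv_neg_dτ`). This is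
how `t*λ` and `s*λ` transform.

Finally, strictness of `ω` gives `ω̃₀(δ_p B) = B + τλ(δ_p B)`, and `κ(p, B) = (-λ(δ_p B), B + τλ(δ_p
B))` is an arrow from this element to `B`. Naturality is a cancellation once `δ` is known to commute
with source and target. -/

theorem tangentMap_mk_of_eq {f : M₁ → M₂} {x : M₁} {y : M₂} (h : f x = y) (v : E₁) :
    tangentMap I₁ I₂ f ⟨x, v⟩ = ⟨y, (mfderiv I₁ I₂ f x v : E₂)⟩ := by
  subst h; rfl

theorem tangentBundle_mk_inj {x : M₁} {v w : E₁}
    (h : (⟨x, v⟩ : TangentBundle I₁ M₁) = ⟨x, w⟩) : v = w := by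
  cases h; rfl

theorem tangentMap_congr_of_eventuallyEq {f g : M₁ → M₂} {p : TangentBundle I₁ M₁}
    (h : f =ᶠ[nhds p.1] g) : tangentMap I₁ I₂ f p = tangentMap I₁ I₂ g p := by
  obtain ⟨x, v⟩ := p
  refine (tangentMap_mk_of_eq (E₁ := E₁) h.eq_of_nhds v).trans ?_
  have h' : mfderiv I₁ I₂ f x = mfderiv I₁ I₂ g x := h.mfderiv_eq
  rw [h']
  rfl

theorem tangentMap_prodMk {f : M₁ → M₂} {g : M₁ → M₃} {p : TangentBundle I₁ M₁}
    (hf : MDifferentiableAt I₁ I₂ f p.1) (hg : MDifferentiableAt I₁ I₃ g p.1) :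
    tangentMap I₁ (I₂.prod I₃) (fun x => (f x, g x)) p =
      (equivTangentBundleProd I₂ M₂ I₃ M₃).symm (tangentMap I₁ I₂ f p, tangentMap I₁ I₃ g p) := by
  simp only [tangentMap, mfderiv_prodMk hf hg]
  rfl

theorem tangentMap_fst_equivTangentBundleProd_symm
    (c : TangentBundle I₁ M₁ × TangentBundle I₂ M₂) :
    tangentMap (I₁.prod I₂) I₁ Prod.fst ((equivTangentBundleProd I₁ M₁ I₂ M₂).symm c) = c.1 := by
  rw [tangentMap_prodFst]; rfl

theorem tangentMap_snd_equivTangentBundleProd_symm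
    (c : TangentBundle I₁ M₁ × TangentBundle I₂ M₂) :
    tangentMap (I₁.prod I₂) I₂ Prod.snd ((equivTangentBundleProd I₁ M₁ I₂ M₂).symm c) = c.2 := by
  rw [tangentMap_prodSnd]; rfl

/-- Since `T⁻¹(s)` is a neighbourhood of the base point, the chain rule within `s` yields an
unrestricted derivative of `f ∘ T`, which is unique. Thus any derivative of `f` within `s` has the
same values on the image of `dT`, and no unique differentiability of `s` is required. -/
theorem tangentMapWithin_tangentMap {f : M₂ → M₃} {s : Set M₂} {T : M₁ → M₂}
    {p : TangentBundle I₁ M₁} (hf : MDifferentiableWithinAt I₂ I₃ f s (T p.1))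
    (hT : MDifferentiableAt I₁ I₂ T p.1) (hs : ∀ᶠ c in nhds p.1, T c ∈ s) :
    tangentMapWithin I₂ I₃ f s (tangentMap I₁ I₂ T p) = tangentMap I₁ I₃ (f ∘ T) p ∧
      MDifferentiableAt I₁ I₃ (f ∘ T) p.1 := by
  have h := (hf.hasMFDerivWithinAt.comp p.1 (hT.hasMFDerivAt.hasMFDerivWithinAt (s := T ⁻¹' s))
    subset_rfl).hasMFDerivAt hs
  refine ⟨?_, h.mdifferentiableAt⟩
  simp only [tangentMapWithin, tangentMap, h.mfderiv]
  rfl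

/-- A submersion `f` has local sections through all nearby points, depending smoothly on them. -/
theorem Manifold.IsSubmersionAt.exists_local_lift [I₁.Boundaryless] [I₂.Boundaryless]
    {f : M₁ → M₂} {x : M₁} (h : Manifold.IsSubmersionAt I₁ I₂ ∞ f x) :
    ∃ S : M₂ × M₁ → M₁, MDifferentiableAt (I₂.prod I₁) I₁ S (f x, x) ∧
      (∀ᶠ m in nhds x, S (f m, m) = m) ∧ (∀ᶠ c in nhds (f x, x), f (S c) = c.1) := by
  let φ := h.domChart.extend I₁
  let ψ := h.codChart.extend I₂
  have hφx : x ∈ h.domChart.source := h.mem_domChart_source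
  have hψx : f x ∈ h.codChart.source := h.mem_codChart_source
  have hφt : IsOpen φ.target := h.domChart.isOpen_extend_target
  let u : M₂ × M₁ → E₁ := fun c => h.equiv.symm (ψ c.1, (h.equiv (φ c.2)).2)
  have hφs : φ.source = h.domChart.source := h.domChart.extend_source
  have hψs : ψ.source = h.codChart.source := h.codChart.extend_source
  have hu : ∀ m ∈ h.domChart.source, u (f m, m) = φ m := by
    intro m hm
    have h₁ := h.writtenInCharts (φ.map_source (hφs ▸ hm))
    simp only [Function.comp_apply] at h₁
    change ψ (f (φ.symm (φ m))) = _ at h₁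
    rw [φ.left_inv (hφs ▸ hm)] at h₁
    change h.equiv.symm (ψ (f m), (h.equiv (φ m)).2) = φ m
    rw [h₁]
    exact h.equiv.symm_apply_apply _
  have hφd : MDifferentiableAt I₁ 𝓘(ℝ, E₁) φ x :=
    (OpenPartialHomeomorph.contMDiffAt_extend h.domChart_mem_maximalAtlas hφx).mdifferentiableAt (by simp)
  have hψd : MDifferentiableAt I₂ 𝓘(ℝ, E₂) ψ (f x) :=
    (OpenPartialHomeomorph.contMDiffAt_extend h.codChart_mem_maximalAtlas hψx).mdifferentiableAt (by simp)
  have hud : MDifferentiableAt (I₂.prod I₁) 𝓘(ℝ, E₁) u (f x, x) := by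
    have h₂ : MDifferentiableAt (I₂.prod I₁) 𝓘(ℝ, E₁) (fun c : M₂ × M₁ => φ c.2) (f x, x) :=
      hφd.comp (f x, x) mdifferentiableAt_snd
    have h₁ : MDifferentiableAt (I₂.prod I₁) 𝓘(ℝ, E₂) (fun c : M₂ × M₁ => ψ c.1) (f x, x) :=
      hψd.comp (f x, x) mdifferentiableAt_fst
    have h₃ : MDifferentiableAt (I₂.prod I₁) 𝓘(ℝ, h.complement)
        (fun c : M₂ × M₁ => (h.equiv (φ c.2)).2) (f x, x) :=
      (((ContinuousLinearMap.snd ℝ E₂ h.complement).comp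
        (h.equiv : E₁ →L[ℝ] E₂ × h.complement)).mdifferentiableAt).comp (f x, x) h₂
    exact ((h.equiv.symm : E₂ × h.complement →L[ℝ] E₁).mdifferentiableAt).comp (f x, x)
      (h₁.prodMk_space h₃)
  have hux : u (f x, x) = φ x := hu x hφx
  have hsymm : MDifferentiableAt 𝓘(ℝ, E₁) I₁ φ.symm (φ x) := by
    have hx : φ x ∈ φ.target := φ.map_source (hφs ▸ hφx)
    exact ((contMDiffOn_extend_symm h.domChart_mem_maximalAtlas).contMDiffAt
      (by rw [← h.domChart.extend_target']; exact hφt.mem_nhds hx)).mdifferentiableAt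
        (by simp)
  refine ⟨fun c => φ.symm (u c), ?_, ?_, ?_⟩
  · exact MDifferentiableAt.comp (f x, x) (hux ▸ hsymm) hud
  · filter_upwards [h.domChart.open_source.mem_nhds hφx] with m hm
    rw [hu m hm, φ.left_inv (hφs ▸ hm)]
  · have h₁ : ∀ᶠ c in nhds (f x, x), u c ∈ φ.target :=
      hud.continuousAt.eventually_mem (hφt.mem_nhds (hux ▸ φ.map_source (hφs ▸ hφx)))
    have h₂ : ∀ᶠ c : M₂ × M₁ in nhds (f x, x), c.1 ∈ h.codChart.source :=
      continuousAt_fst.eventually_mem (h.codChart.open_source.mem_nhds hψx)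
    filter_upwards [h₁, h₂] with c hc₁ hc₂
    have h₃ : ψ (f (φ.symm (u c))) = (h.equiv (u c)).1 := h.writtenInCharts hc₁
    have h₄ : h.equiv (u c) = (ψ c.1, (h.equiv (φ c.2)).2) := h.equiv.apply_symm_apply _
    rw [h₄] at h₃
    refine ψ.injOn ?_ (hψs ▸ hc₂) h₃
    rw [hψs]
    exact h.source_subset_preimage_source (hφs ▸ φ.map_target hc₁)

end TangentMap

/-! ### Source and target of a composite in the tangent groupoid -/

section TangentGroupoid

variable {V₁ W₁ V₀ W₀ : Type*} [NormedAddCommGroup V₁] [NormedSpace ℝ V₁] [TopologicalSpace W₁]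
  [NormedAddCommGroup V₀] [NormedSpace ℝ V₀] [TopologicalSpace W₀]
  {I₁ : ModelWithCorners ℝ V₁ W₁} {M₁ : Type*} [TopologicalSpace M₁] [ChartedSpace W₁ M₁]
  {I₀ : ModelWithCorners ℝ V₀ W₀} {M₀ : Type*} [TopologicalSpace M₀] [ChartedSpace W₀ M₀]

/-- Near a composable pair there is a retraction onto the fibre product of composable pairs which
fixes a given tangent vector of the fibre product and the second component. -/
theorem LieGroupoid.exists_local_retraction [I₁.Boundaryless] [I₀.Boundaryless]
    (A : LieGroupoid I₁ M₁ I₀ M₀) {b a : TangentBundle I₁ M₁}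
    (hab : tangentMap I₁ I₀ A.src b = tangentMap I₁ I₀ A.tgt a) :
    ∃ T : M₁ × M₁ → M₁ × M₁,
      MDifferentiableAt (I₁.prod I₁) (I₁.prod I₁) T (b.1, a.1) ∧
      T (b.1, a.1) = (b.1, a.1) ∧ (∀ c, (T c).2 = c.2) ∧
      (∀ᶠ c in nhds (b.1, a.1), T c ∈ A.composable) ∧
      tangentMap (I₁.prod I₁) (I₁.prod I₁) T ((equivTangentBundleProd I₁ M₁ I₁ M₁).symm (b, a)) =
        (equivTangentBundleProd I₁ M₁ I₁ M₁).symm (b, a) := by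
  obtain ⟨S, hSd, hS₁, hS₂⟩ := (A.submersion_src.isSubmersionAt b.1).exists_local_lift
  have h₀ : A.src b.1 = A.tgt a.1 := congrArg Bundle.TotalSpace.proj hab
  have hsrc : MDifferentiable I₁ I₀ A.src := A.smooth_src.mdifferentiable (by simp)
  have htgt : MDifferentiable I₁ I₀ A.tgt := A.smooth_tgt.mdifferentiable (by simp)
  -- The map sought is `T(c₁, c₂) = (S(tgt c₂, c₁), c₂)`: it moves `c₁` to an arrow whose source is
  -- `tgt c₂`.
  let r : M₁ × M₁ → M₀ × M₁ := fun c => (A.tgt c.2, c.1)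
  have hr : MDifferentiable (I₁.prod I₁) (I₀.prod I₁) r :=
    (htgt.comp mdifferentiable_snd).prodMk mdifferentiable_fst
  have hr₀ : r (b.1, a.1) = (A.src b.1, b.1) := by simp only [r, h₀]
  have hSd' : MDifferentiableAt (I₀.prod I₁) I₁ S (r (b.1, a.1)) := hr₀ ▸ hSd
  have hSr : MDifferentiableAt (I₁.prod I₁) I₁ (S ∘ r) (b.1, a.1) := hSd'.comp _ (hr _)
  set p := (equivTangentBundleProd I₁ M₁ I₁ M₁).symm (b, a)
  refine ⟨fun c => ((S ∘ r) c, c.2), hSr.prodMk mdifferentiableAt_snd, ?_, fun _ => rfl, ?_, ?_⟩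
  · simp only [Function.comp_apply, hr₀, hS₁.self_of_nhds]
  · have hc : Filter.Tendsto r (nhds (b.1, a.1)) (nhds (A.src b.1, b.1)) :=
      hr₀ ▸ (hr _).continuousAt.tendsto
    filter_upwards [hc.eventually hS₂] with c hc
    exact hc
  · rw [tangentMap_prodMk hSr mdifferentiableAt_snd, tangentMap_comp_at p hSd' (hr _),
      tangentMap_snd_equivTangentBundleProd_symm]
    -- Because `Ts(b) = Tt(a)`, the differential of `r` at `(b, a)` agrees with that of `m ↦ (src m,
    -- m)` at `b`. Since `S(src m, m) = m` near the base point, the first component of `dT(b, a)` is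
    -- `b`.
    have h₁ : tangentMap (I₁.prod I₁) (I₀.prod I₁) r p =
        tangentMap I₁ (I₀.prod I₁) (fun m => (A.src m, m)) b := by
      have h₂ := tangentMap_prodMk (p := p) (f := A.tgt ∘ Prod.snd) (g := Prod.fst)
        ((htgt.comp mdifferentiable_snd) _) mdifferentiableAt_fst
      have h₃ := tangentMap_prodMk (p := b) (f := A.src) (g := id) (hsrc _) mdifferentiableAt_id
      rw [tangentMap_comp_at p (htgt _) mdifferentiableAt_snd,
        tangentMap_snd_equivTangentBundleProd_symm,
        tangentMap_fst_equivTangentBundleProd_symm, ← hab] at h₂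
      rw [tangentMap_id] at h₃
      exact h₂.trans h₃.symm
    rw [h₁, ← tangentMap_comp_at (f := fun m => (A.src m, m)) b hSd
      ((hsrc _).prodMk mdifferentiableAt_id),
      tangentMap_congr_of_eventuallyEq (f := S ∘ fun m => (A.src m, m)) (g := id) hS₁, tangentMap_id]
    rfl

theorem LieGroupoid.tangentMap_src_and_tgt_comp [I₁.Boundaryless] [I₀.Boundaryless]
    (A : LieGroupoid I₁ M₁ I₀ M₀) {b a : TangentBundle I₁ M₁}
    (hab : tangentMap I₁ I₀ A.src b = tangentMap I₁ I₀ A.tgt a) :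
    tangentMap I₁ I₀ A.src ((A.toGroupoidOps.tangent I₁ I₀).comp b a) =
        tangentMap I₁ I₀ A.src a ∧
      tangentMap I₁ I₀ A.tgt ((A.toGroupoidOps.tangent I₁ I₀).comp b a) =
        tangentMap I₁ I₀ A.tgt b := by
  obtain ⟨T, hTd, hT₀, hT₂, hTc, hTp⟩ := A.exists_local_retraction hab
  have h₀ : A.src b.1 = A.tgt a.1 := congrArg Bundle.TotalSpace.proj hab
  have hsrc : MDifferentiable I₁ I₀ A.src := A.smooth_src.mdifferentiable (by simp)
  have htgt : MDifferentiable I₁ I₀ A.tgt := A.smooth_tgt.mdifferentiable (by simp)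
  set p := (equivTangentBundleProd I₁ M₁ I₁ M₁).symm (b, a)
  have hcomp : MDifferentiableWithinAt (I₁.prod I₁) I₁ (fun c : M₁ × M₁ => A.comp c.1 c.2)
      A.composable (T (b.1, a.1)) := by
    rw [hT₀]
    exact (A.smooth_comp _ h₀).mdifferentiableWithinAt (by simp)
  obtain ⟨h₁, h₂⟩ := tangentMapWithin_tangentMap (p := p) hcomp hTd hTc
  -- As `dT` fixes `(b, a)`, the derivative within the fibre product becomes the tangent map of
  -- `comp ∘ T`, to which the ordinary chain rule applies.
  have h₃ : (A.toGroupoidOps.tangent I₁ I₀).comp b a =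
      tangentMap (I₁.prod I₁) I₁ ((fun c : M₁ × M₁ => A.comp c.1 c.2) ∘ T) p := by
    rw [← h₁, hTp]; rfl
  rw [h₃, ← tangentMap_comp_at p (hsrc _) h₂, ← tangentMap_comp_at p (htgt _) h₂]
  constructor
  · rw [tangentMap_congr_of_eventuallyEq (g := A.src ∘ Prod.snd),
      tangentMap_comp_at p (hsrc _) mdifferentiableAt_snd,
      tangentMap_snd_equivTangentBundleProd_symm]
    filter_upwards [hTc] with c hc
    simp only [Function.comp_apply]
    rw [A.isGroupoid.src_comp _ _ hc, hT₂]
  · rw [tangentMap_congr_of_eventuallyEq (g := (A.tgt ∘ Prod.fst) ∘ T),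
      tangentMap_comp_at p ((htgt.comp mdifferentiable_fst) _) hTd, hTp,
      tangentMap_comp_at p (htgt _) mdifferentiableAt_fst,
      tangentMap_fst_equivTangentBundleProd_symm]
    filter_upwards [hTc] with c hc
    simp only [Function.comp_apply]
    rw [A.isGroupoid.tgt_comp _ _ hc]

end TangentGroupoid

/-! ### Differentials at the identity of a Lie group -/

section LieGroupLemmas

variable {VG WG : Type*} [NormedAddCommGroup VG] [NormedSpace ℝ VG] [TopologicalSpace WG]
  {IG : ModelWithCorners ℝ VG WG} {G : Type*} [TopologicalSpace G] [ChartedSpace WG G] [Group G]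
  {V W : Type*} [NormedAddCommGroup V] [NormedSpace ℝ V] [TopologicalSpace W]
  {I : ModelWithCorners ℝ V W} {M : Type*} [TopologicalSpace M] [ChartedSpace W M]

theorem contMDiff_tangentBundle_mk [IsManifold I ∞ M] (x : M) :
    ContMDiff 𝓘(ℝ, V) I.tangent ∞ (fun v : V => (⟨x, v⟩ : TangentBundle I M)) := by
  intro v
  rw [Bundle.contMDiffAt_totalSpace]
  refine ⟨contMDiffAt_const, ?_⟩
  let L : V →L[ℝ] V := (trivializationAt V (TangentSpace I) x).continuousLinearMapAt ℝ x
  have h : (fun w : V => (trivializationAt V (TangentSpace I) x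
      (⟨x, w⟩ : TangentBundle I M)).2) = L := by
    ext w
    have h' := (trivializationAt V (TangentSpace I) x).coe_linearMapAt_of_mem (R := ℝ)
      (FiberBundle.mem_baseSet_trivializationAt' x)
    exact (congrFun h' w).symm
  exact h ▸ L.contDiff.contMDiff v

variable (IG) in
theorem tangentMap_conj_one (g : G) (B : LieAlg IG G) :
    tangentMap IG IG (fun x : G => g * x * g⁻¹) ⟨1, B⟩ = ⟨1, adjoint IG g B⟩ :=
  tangentMap_mk_of_eq (by simp) B

variable [LieGroup IG ∞ G]

variable (IG) in
theorem mdifferentiable_conj (g : G) : MDifferentiable IG IG (fun x : G => g * x * g⁻¹) :=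
  (((contMDiff_const (c := g)).mul contMDiff_id).mul contMDiff_const).mdifferentiable
    (n := ∞) (by simp)

/-- Differentiate `g F(y) g⁻¹ = F(φ y)` at a fixed point of `φ`. Every formula for the adjoint
action below is an instance, with `F` a parametrization of the relevant subgroup. -/
theorem adjoint_mfderiv_of_semiconj {g : G} {F : M → G} {φ : M → M} {x : M}
    (hF : MDifferentiableAt I IG F x) (hφ : MDifferentiableAt I I φ x)
    (hFx : F x = 1) (hφx : φ x = x) (h : ∀ y, g * F y * g⁻¹ = F (φ y)) (v : V) :
    adjoint IG g (mfderiv I IG F x v) = mfderiv I IG F x (mfderiv I I φ x v) := by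
  refine tangentBundle_mk_inj (I₁ := IG) (x := (1 : G)) ?_
  calc
    _ = tangentMap IG IG (fun y : G => g * y * g⁻¹) (tangentMap I IG F ⟨x, v⟩) :=
      (tangentMap_conj_one IG g _).symm.trans
        (congrArg _ (tangentMap_mk_of_eq (E₁ := V) hFx v).symm)
    _ = tangentMap I IG ((fun y => g * y * g⁻¹) ∘ F) ⟨x, v⟩ :=
      (tangentMap_comp_at ⟨x, v⟩ (mdifferentiable_conj IG g _) hF).symm
    _ = tangentMap I IG (F ∘ φ) ⟨x, v⟩ := by
      rw [show (fun y => g * y * g⁻¹) ∘ F = F ∘ φ from funext h]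
    _ = tangentMap I IG F (tangentMap I I φ ⟨x, v⟩) :=
      tangentMap_comp_at ⟨x, v⟩ (by simpa [hφx] using hF) hφ
    _ = _ := (congrArg _ (tangentMap_mk_of_eq (E₁ := V) hφx v)).trans
      (tangentMap_mk_of_eq (E₁ := V) hFx _)

variable (IG) in
theorem mfderiv_mul_one (A B : LieAlg IG G) :
    (mfderiv (IG.prod IG) IG (fun c : G × G => c.1 * c.2) (1, 1) (A, B) : VG) = A + B := by
  have h₁ : mfderiv IG IG (fun x : G => x * 1) 1 = ContinuousLinearMap.id ℝ VG := by
    rw [show (fun x : G => x * 1) = id from funext mul_one]; exact mfderiv_id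
  have h₂ : mfderiv IG IG (fun x : G => 1 * x) 1 = ContinuousLinearMap.id ℝ VG := by
    rw [show (fun x : G => 1 * x) = id from funext one_mul]; exact mfderiv_id
  refine (mfderiv_prod_eq_add_apply (p := ((1 : G), (1 : G))) (v := (A, B))
    ((contMDiff_mul IG ∞).mdifferentiable (by simp) _)).trans ?_
  exact congrArg₂ (fun f g : VG →L[ℝ] VG => f A + g B) h₁ h₂

variable (IG) in
-- Differentiating `x x⁻¹ = 1` at `1`, where multiplication has differential `(A, B) ↦ A + B`.
theorem mfderiv_inv_one (B : LieAlg IG G) :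
    (mfderiv IG IG (fun x : G => x⁻¹) 1 B : VG) = -B := by
  have hinv : MDifferentiable IG IG (fun x : G => x⁻¹) :=
    (contMDiff_inv IG ∞).mdifferentiable (by simp)
  have hmul : MDifferentiable (IG.prod IG) IG (fun c : G × G => c.1 * c.2) :=
    (contMDiff_mul IG ∞).mdifferentiable (by simp)
  have h₁ : tangentMap IG IG (fun x : G => x * x⁻¹) ⟨1, B⟩ = ⟨1, (0 : VG)⟩ := by
    rw [show (fun x : G => x * x⁻¹) = fun _ => 1 by simp]
    refine (tangentMap_mk_of_eq rfl B).trans ?_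
    rw [mfderiv_const]; rfl
  have h₂ : tangentMap IG (IG.prod IG) (fun x : G => (x, x⁻¹)) ⟨1, B⟩ =
      ⟨(1, 1), (B, (mfderiv IG IG (fun x : G => x⁻¹) 1 B : VG))⟩ := by
    refine (tangentMap_mk_of_eq (y := ((1 : G), (1 : G))) (by simp) B).trans ?_
    refine congrArg (Bundle.TotalSpace.mk (E := TangentSpace (IG.prod IG)) ((1 : G), (1 : G))) ?_
    refine (congrArg (fun f => f B) (mfderiv_prodMk (x := (1 : G)) (f := id) (g := fun x => x⁻¹)
      mdifferentiableAt_id (hinv _))).trans ?_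
    rw [mfderiv_id]
    rfl
  have h₃ : (mfderiv (IG.prod IG) IG (fun c : G × G => c.1 * c.2) (1, 1)
      (B, (mfderiv IG IG (fun x : G => x⁻¹) 1 B : VG)) : VG) = 0 := by
    refine tangentBundle_mk_inj (I₁ := IG) (x := (1 : G)) ?_
    refine (tangentMap_mk_of_eq (by simp) _).symm.trans (Eq.trans ?_ h₁)
    rw [← h₂]
    exact (tangentMap_comp_at (f := fun x : G => (x, x⁻¹)) ⟨1, B⟩ (hmul _)
      (mdifferentiableAt_id.prodMk (hinv _))).symm
  exact eq_neg_of_add_eq_zero_right ((mfderiv_mul_one IG B _).symm.trans h₃)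

end LieGroupLemmas

/-! ### Smooth right actions and fundamental vector fields -/

section Fundamental

variable {VG WG : Type*} [NormedAddCommGroup VG] [NormedSpace ℝ VG] [TopologicalSpace WG]
  {IG : ModelWithCorners ℝ VG WG} {G : Type*} [TopologicalSpace G] [ChartedSpace WG G] [Group G]
  {VP WP : Type*} [NormedAddCommGroup VP] [NormedSpace ℝ VP] [TopologicalSpace WP]
  {IP : ModelWithCorners ℝ VP WP} {P : Type*} [TopologicalSpace P] [ChartedSpace WP P]
  {act : P → G → P}

namespace IsSmoothRightAction

theorem mdifferentiable_left (h : IsSmoothRightAction IG IP act) (g : G) :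
    MDifferentiable IP IP (fun p => act p g) :=
  (h.smooth.comp (contMDiff_id.prodMk contMDiff_const)).mdifferentiable (by simp)

theorem mdifferentiable_right (h : IsSmoothRightAction IG IP act) (p : P) :
    MDifferentiable IG IP (act p) :=
  (h.smooth.comp (contMDiff_const.prodMk contMDiff_id)).mdifferentiable (by simp)

theorem isLinearMap_comp_fundamental [IsManifold IP ∞ P] {V : Type*} [NormedAddCommGroup V]
    [NormedSpace ℝ V] {η : TangentBundle IP P → V} (hη : IsOneForm IP η) (p : P) :
    IsLinearMap ℝ (fun B : LieAlg IG G => η (fundamental IG IP act (p, B))) :=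
  -- The fundamental vector has base point `act p 1`, which is only propositionally `p`, so
  -- linearity of the form is used there.
  ((hη.linear (act p 1)).mk' _ ∘ₗ (mfderiv IG IP (act p) 1).toLinearMap).isLinear

variable [LieGroup IG ∞ G]

/-- The derivative at `k = 1` of `(p g)(g⁻¹ k g) = (p k) g`. -/
theorem fundamental_act (h : IsSmoothRightAction IG IP act) (p : P) (g : G) (B : LieAlg IG G) :
    fundamental IG IP act (act p g, adjoint IG g⁻¹ B) =
      tangentAct IP act (fundamental IG IP act (p, B)) g := by
  simp only [fundamental, tangentAct]
  rw [← tangentMap_conj_one]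
  refine (tangentMap_comp_at (g := act (act p g)) _ (h.mdifferentiable_right _ _)
    (mdifferentiable_conj IG g⁻¹ _)).symm.trans ?_
  refine Eq.trans ?_ (tangentMap_comp_at (g := fun p => act p g) (f := act p) _
    (h.mdifferentiable_left _ _) (h.mdifferentiable_right _ _))
  congr 1
  ext x
  simp only [Function.comp_apply, ← h.act_mul]
  congr 1
  group

/-- Joint smoothness in `(p, B)` holds because `δ_p(B)` is the tangent map of the whole action `P ×
G → P` at the vector `(0_p, B)` over `(p, 1)`. -/
theorem contMDiff_fundamental [IsManifold IP ∞ P] (h : IsSmoothRightAction IG IP act) :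
    ContMDiff (IP.prod 𝓘(ℝ, LieAlg IG G)) IP.tangent ∞ (fundamental IG IP act) := by
  have h₁ : fundamental IG IP act = fun c => tangentMap (IP.prod IG) IP
      (fun c : P × G => act c.1 c.2) ((equivTangentBundleProd IP P IG G).symm
        ((⟨c.1, (0 : VP)⟩ : TangentBundle IP P), ⟨1, c.2⟩)) := by
    ext1 ⟨p, B⟩
    refine (tangentMap_comp_at (f := fun g : G => (p, g)) (g := fun c : P × G => act c.1 c.2)
      ⟨1, B⟩ (h.smooth.mdifferentiable (by simp) _)
      (mdifferentiableAt_const.prodMk mdifferentiableAt_id)).trans ?_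
    congr 1
    exact tangentMap_prod_right
  rw [h₁]
  refine (h.smooth.contMDiff_tangentMap (m := ∞) (by simp)).comp
    (contMDiff_equivTangentBundleProd_symm.comp (ContMDiff.prodMk ?_ ?_))
  · exact (Bundle.contMDiff_zeroSection ℝ (TangentSpace IP)).comp contMDiff_fst
  · exact (contMDiff_tangentBundle_mk (I := IG) (1 : G)).comp contMDiff_snd

end IsSmoothRightAction

theorem IsOneForm.comp_tangentMap [IsManifold IP ∞ P]
    {VQ WQ : Type*} [NormedAddCommGroup VQ] [NormedSpace ℝ VQ] [TopologicalSpace WQ]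
    {IQ : ModelWithCorners ℝ VQ WQ} {Q : Type*} [TopologicalSpace Q] [ChartedSpace WQ Q]
    [IsManifold IQ ∞ Q] {V : Type*} [NormedAddCommGroup V] [NormedSpace ℝ V]
    {η : TangentBundle IQ Q → V} (hη : IsOneForm IQ η) {f : P → Q} (hf : ContMDiff IP IQ ∞ f) :
    IsOneForm IP (fun v => η (tangentMap IP IQ f v)) where
  smooth := hη.smooth.comp (hf.contMDiff_tangentMap (by simp))
  linear p := ((hη.linear (f p)).mk' _ ∘ₗ (mfderiv IP IQ f p).toLinearMap).isLinear

end Fundamental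

/-! ### The adjoint action of the 2-group on the kernels of source and target -/

namespace LieCrossedModule

variable {VG WG : Type*} [NormedAddCommGroup VG] [NormedSpace ℝ VG] [TopologicalSpace WG]
  {IG : ModelWithCorners ℝ VG WG} {G : Type*} [TopologicalSpace G] [ChartedSpace WG G] [Group G]
  {VH WH : Type*} [NormedAddCommGroup VH] [NormedSpace ℝ VH] [TopologicalSpace WH]
  {IH : ModelWithCorners ℝ VH WH} {H : Type*} [TopologicalSpace H] [ChartedSpace WH H] [Group H]
  (C : LieCrossedModule IG G IH H)

theorem mdifferentiable_τ : MDifferentiable IH IG C.τ := C.smooth_τ.mdifferentiable (by simp)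

theorem mdifferentiable_α (g : G) : MDifferentiable IH IH (fun h : H => C.α g h) :=
  (C.smooth_α.comp (contMDiff_const.prodMk contMDiff_id)).mdifferentiable (by simp)

theorem arrow_mul (h h' : H) (g g' : G) :
    C.arrow h g * C.arrow h' g' = C.arrow (h * C.α g h') (g * g') := rfl

theorem arrow_inv (h : H) (g : G) : (C.arrow h g)⁻¹ = C.arrow (C.α g⁻¹ h⁻¹) g⁻¹ := rfl

theorem adjointArrows_add (k : C.Arrows) (K L : C.LieArrows) :
    C.adjointArrows k (K + L) = C.adjointArrows k K + C.adjointArrows k L :=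
  map_add (mfderiv (IH.prod IG) (IH.prod IG) (fun x : C.Arrows => k * x * k⁻¹) 1) K L

theorem mdifferentiable_arrow_one : MDifferentiable IH (IH.prod IG) (fun h => C.arrow h 1) :=
  mdifferentiable_id.prodMk mdifferentiable_const

theorem mdifferentiable_one_arrow : MDifferentiable IG (IH.prod IG) (fun g => C.arrow 1 g) :=
  mdifferentiable_const.prodMk mdifferentiable_id

theorem mfderiv_arrow_one (A : LieAlg IH H) :
    (mfderiv IH (IH.prod IG) (fun h => C.arrow h 1) 1 A : VH × VG) = (A, 0) := by
  refine (congrArg (fun f => f A) (mfderiv_prodMk (I := IH) (I' := IH) (I'' := IG)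
    (f := fun h : H => h) (g := fun _ : H => (1 : G)) (x := 1) mdifferentiableAt_id mdifferentiableAt_const)).trans ?_
  rw [mfderiv_const]
  erw [mfderiv_id]
  rfl

theorem mfderiv_one_arrow (B : LieAlg IG G) :
    (mfderiv IG (IH.prod IG) (fun g => C.arrow 1 g) 1 B : VH × VG) = (0, B) := by
  refine (congrArg (fun f => f B) (mfderiv_prodMk (I := IG) (I' := IH) (I'' := IG)
    (f := fun _ : G => (1 : H)) (g := fun g : G => g) (x := 1) mdifferentiableAt_const mdifferentiableAt_id)).trans ?_
  rw [mfderiv_const]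
  erw [mfderiv_id]
  rfl

theorem mfderiv_src_one (K : C.LieArrows) :
    (mfderiv (IH.prod IG) IG C.twoGroup.src 1 K : VG) = K.2 :=
  congrArg (fun f => f K) (mfderiv_snd (I := IH) (I' := IG) (x := ((1 : H), (1 : G))))

theorem mdifferentiable_src : MDifferentiable (IH.prod IG) IG C.twoGroup.src :=
  mdifferentiable_snd (I := IH) (I' := IG) (M := H) (M' := G)

theorem dτ_add (A B : LieAlg IH H) : C.dτ (A + B) = C.dτ A + C.dτ B :=
  map_add (mfderiv IH IG C.τ 1) A B

theorem dτ_neg (A : LieAlg IH H) : C.dτ (-A) = -C.dτ A := map_neg (mfderiv IH IG C.τ 1) A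

theorem dτ_sub (A B : LieAlg IH H) : C.dτ (A - B) = C.dτ A - C.dτ B :=
  map_sub (mfderiv IH IG C.τ 1) A B

theorem dτ_smul (c : ℝ) (A : LieAlg IH H) : C.dτ (c • A) = c • C.dτ A :=
  map_smul (mfderiv IH IG C.τ 1) c A

theorem contDiff_dτ : ContDiff ℝ ∞ C.dτ := by
  let L : VH →L[ℝ] VG := mfderiv IH IG C.τ 1
  exact L.contDiff

section

variable [LieGroup IH ∞ H]

theorem mdifferentiable_inv_arrow_τ :
    MDifferentiable IH (IH.prod IG) (fun h => C.arrow h⁻¹ (C.τ h)) :=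
  ((contMDiff_inv IH ∞).mdifferentiable (by simp)).prodMk C.mdifferentiable_τ

theorem mfderiv_inv_arrow_τ (A : LieAlg IH H) :
    (mfderiv IH (IH.prod IG) (fun h => C.arrow h⁻¹ (C.τ h)) 1 A : VH × VG) = (-A, C.dτ A) := by
  refine (congrArg (fun f => f A) (mfderiv_prodMk (I := IH) (I' := IH) (I'' := IG)
    (f := fun h : H => h⁻¹) (g := C.τ) (x := 1) ((contMDiff_inv IH ∞).mdifferentiable (by simp) _)
    (C.mdifferentiable_τ _))).trans ?_
  exact Prod.ext (mfderiv_inv_one IH A) rfl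

end

variable [LieGroup IG ∞ G]

theorem mdifferentiable_tgt : MDifferentiable (IH.prod IG) IG C.twoGroup.tgt := by
  have hd : MDifferentiable (IH.prod IG) IG (fun c : H × G => C.τ c.1 * c.2) :=
    ((C.smooth_τ.comp contMDiff_fst).mul contMDiff_snd).mdifferentiable (n := ∞) (by simp)
  exact hd

theorem mfderiv_tgt_one (K : C.LieArrows) :
    (mfderiv (IH.prod IG) IG C.twoGroup.tgt 1 K : VG) = C.dτ K.1 + K.2 := by
  refine (mfderiv_prod_eq_add_apply (p := ((1 : H), (1 : G))) (v := K)
    (C.mdifferentiable_tgt _)).trans ?_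
  have h₁ : mfderiv IH IG (fun z : H => C.τ z * 1) 1 = mfderiv IH IG C.τ 1 := by
    rw [show (fun z : H => C.τ z * 1) = C.τ from funext fun z => mul_one _]
  have h₂ : mfderiv IG IG (fun z : G => C.τ 1 * z) 1 = ContinuousLinearMap.id ℝ VG := by
    rw [show (fun z : G => C.τ 1 * z) = id from funext fun z => by simp]; exact mfderiv_id
  exact congrArg₂ (fun (f : VH →L[ℝ] VG) (g : VG →L[ℝ] VG) => f K.1 + g K.2) h₁ h₂

/-- The infinitesimal form of `τ(α(g, h)) = g τ(h) g⁻¹`. -/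
theorem adjoint_dτ (g : G) (A : LieAlg IH H) :
    adjoint IG g (C.dτ A) = C.dτ (C.dα g A) :=
  adjoint_mfderiv_of_semiconj (C.mdifferentiable_τ _) (C.mdifferentiable_α g _) (map_one _)
    (map_one _) (fun h => (C.τ_α g h).symm) A

variable [LieGroup IH ∞ H]

/-- `(A, 0)` is tangent to `y ↦ (y, 1)`, the kernel of the source. This kernel commutes with the
kernel of the target, so conjugation by `k` on it depends only on `t(k)`. -/
theorem adjointArrows_inv_fst (k : C.Arrows) (A : LieAlg IH H) :
    C.adjointArrows k⁻¹ (A, 0) = (C.dα (C.twoGroup.tgt k)⁻¹ A, 0) := by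
  obtain ⟨h, g⟩ := k
  change C.adjointArrows (C.arrow h g)⁻¹ (A, 0) = (C.dα (C.τ h * g)⁻¹ A, 0)
  rw [← C.mfderiv_arrow_one, ← C.mfderiv_arrow_one]
  refine adjoint_mfderiv_of_semiconj (C.mdifferentiable_arrow_one _) (C.mdifferentiable_α _ _)
    rfl (map_one _) (fun y => ?_) A
  rw [inv_inv, arrow_inv, arrow_mul, arrow_mul]
  -- The Peiffer identity turns `h⁻¹ y h` into `α(τ(h)⁻¹, y)`, which combines with `α(g⁻¹, ·)` into
  -- the action of `(τ(h) g)⁻¹`.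
  have h₁ := C.α_τ h⁻¹ y
  simp only [map_inv, inv_inv] at h₁
  simp [h₁, mul_assoc]

/-- `(-A, τA)` is tangent to `y ↦ (y⁻¹, τ y)`, the kernel of the target. It commutes with the kernel
of the source, so for `k = (h, g) = (h, 1)(1, g)` only `g = s(k)` acts. -/
theorem adjointArrows_inv_neg_dτ (k : C.Arrows) (A : LieAlg IH H) :
    C.adjointArrows k⁻¹ (-A, C.dτ A) =
      (-C.dα (C.twoGroup.src k)⁻¹ A, C.dτ (C.dα (C.twoGroup.src k)⁻¹ A)) := by
  obtain ⟨h, g⟩ := k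
  change C.adjointArrows (C.arrow h g)⁻¹ (-A, C.dτ A) = (-C.dα g⁻¹ A, C.dτ (C.dα g⁻¹ A))
  rw [← C.mfderiv_inv_arrow_τ, ← C.mfderiv_inv_arrow_τ]
  refine adjoint_mfderiv_of_semiconj (C.mdifferentiable_inv_arrow_τ _) (C.mdifferentiable_α _ _)
    (by simp; rfl) (map_one _) (fun y => ?_) A
  rw [inv_inv, arrow_inv, arrow_mul, arrow_mul, C.τ_α]
  simp [C.α_τ, mul_assoc]

theorem adjointArrows_unit_inv_snd (g : G) (B : LieAlg IG G) :
    C.adjointArrows (C.twoGroup.unit g)⁻¹ (0, B) = (0, adjoint IG g⁻¹ B) := by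
  change C.adjointArrows (C.arrow 1 g)⁻¹ (0, B) = _
  rw [← C.mfderiv_one_arrow, ← C.mfderiv_one_arrow]
  refine adjoint_mfderiv_of_semiconj (C.mdifferentiable_one_arrow _) (mdifferentiable_conj IG g⁻¹ _)
    rfl (show g⁻¹ * (1 : G) * g⁻¹⁻¹ = 1 by simp) (fun y => ?_) B
  rw [inv_inv, arrow_inv, arrow_mul, arrow_mul]
  simp

end LieCrossedModule

/-! ### Differentials of maps equivariant along a group homomorphism -/

section EquivariantMaps

variable {VG WG : Type*} [NormedAddCommGroup VG] [NormedSpace ℝ VG] [TopologicalSpace WG]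
  {IG : ModelWithCorners ℝ VG WG} {G : Type*} [TopologicalSpace G] [ChartedSpace WG G] [Group G]
  {VP WP : Type*} [NormedAddCommGroup VP] [NormedSpace ℝ VP] [TopologicalSpace WP]
  {IP : ModelWithCorners ℝ VP WP} {P : Type*} [TopologicalSpace P] [ChartedSpace WP P]
  {VK WK : Type*} [NormedAddCommGroup VK] [NormedSpace ℝ VK] [TopologicalSpace WK]
  {IK : ModelWithCorners ℝ VK WK} {K : Type*} [TopologicalSpace K] [ChartedSpace WK K] [Group K]
  {VQ WQ : Type*} [NormedAddCommGroup VQ] [NormedSpace ℝ VQ] [TopologicalSpace WQ]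
  {IQ : ModelWithCorners ℝ VQ WQ} {Q : Type*} [TopologicalSpace Q] [ChartedSpace WQ Q]
  {actP : P → G → P} {actQ : Q → K → Q} {f : P → Q} {θ : G → K}

theorem tangentMap_tangentAct (hP : IsSmoothRightAction IG IP actP)
    (hQ : IsSmoothRightAction IK IQ actQ) (hf : MDifferentiable IP IQ f)
    (h : ∀ p g, f (actP p g) = actQ (f p) (θ g)) (v : TangentBundle IP P) (g : G) :
    tangentMap IP IQ f (tangentAct IP actP v g) =
      tangentAct IQ actQ (tangentMap IP IQ f v) (θ g) := by
  refine (tangentMap_comp_at v (hf _) (hP.mdifferentiable_left g _)).symm.trans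
    (Eq.trans ?_ (tangentMap_comp_at v (hQ.mdifferentiable_left (θ g) _) (hf _)))
  rw [show f ∘ (fun p => actP p g) = (fun q => actQ q (θ g)) ∘ f from funext fun p => h p g]

theorem tangentMap_fundamental (hP : IsSmoothRightAction IG IP actP)
    (hQ : IsSmoothRightAction IK IQ actQ) (hf : MDifferentiable IP IQ f)
    (hθ : MDifferentiable IG IK θ) (hθ₁ : θ 1 = 1)
    (h : ∀ p g, f (actP p g) = actQ (f p) (θ g)) (p : P) (B : LieAlg IG G) :
    tangentMap IP IQ f (fundamental IG IP actP (p, B)) =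
      fundamental IK IQ actQ (f p, (mfderiv IG IK θ 1 B : VK)) := by
  refine (tangentMap_comp_at (f := actP p) ⟨1, B⟩ (hf _) (hP.mdifferentiable_right p _)).symm.trans
    ?_
  rw [show f ∘ actP p = actQ (f p) ∘ θ from funext fun g => h p g]
  refine (tangentMap_comp_at (f := θ) ⟨1, B⟩ (hQ.mdifferentiable_right (f p) _) (hθ _)).trans ?_
  exact congrArg _ (tangentMap_mk_of_eq hθ₁ B)

end EquivariantMaps

/-! ### Source and target of the bundle against the action and `δ` -/

section TwoBundle

variable
  {VG WG : Type*} [NormedAddCommGroup VG] [NormedSpace ℝ VG] [TopologicalSpace WG]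
  {IG : ModelWithCorners ℝ VG WG} {G : Type*} [TopologicalSpace G] [ChartedSpace WG G] [Group G]
  {VH WH : Type*} [NormedAddCommGroup VH] [NormedSpace ℝ VH] [TopologicalSpace WH]
  {IH : ModelWithCorners ℝ VH WH} {H : Type*} [TopologicalSpace H] [ChartedSpace WH H] [Group H]
  {VE₁ WE₁ : Type*} [NormedAddCommGroup VE₁] [NormedSpace ℝ VE₁] [TopologicalSpace WE₁]
  {IE₁ : ModelWithCorners ℝ VE₁ WE₁} {E₁ : Type*} [TopologicalSpace E₁] [ChartedSpace WE₁ E₁]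
  {VE₀ WE₀ : Type*} [NormedAddCommGroup VE₀] [NormedSpace ℝ VE₀] [TopologicalSpace WE₀]
  {IE₀ : ModelWithCorners ℝ VE₀ WE₀} {E₀ : Type*} [TopologicalSpace E₀] [ChartedSpace WE₀ E₀]
  {VX₁ WX₁ : Type*} [NormedAddCommGroup VX₁] [NormedSpace ℝ VX₁] [TopologicalSpace WX₁]
  {IX₁ : ModelWithCorners ℝ VX₁ WX₁} {X₁ : Type*} [TopologicalSpace X₁] [ChartedSpace WX₁ X₁]
  {VX₀ WX₀ : Type*} [NormedAddCommGroup VX₀] [NormedSpace ℝ VX₀] [TopologicalSpace WX₀]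
  {IX₀ : ModelWithCorners ℝ VX₀ WX₀} {X₀ : Type*} [TopologicalSpace X₀] [ChartedSpace WX₀ X₀]
  {C : LieCrossedModule IG G IH H} {𝔼 : LieGroupoid IE₁ E₁ IE₀ E₀}
  {𝕏 : LieGroupoid IX₁ X₁ IX₀ X₀}

theorem LieGroupoid.mdifferentiable_src : MDifferentiable IE₁ IE₀ 𝔼.src :=
  𝔼.smooth_src.mdifferentiable (by simp)

theorem LieGroupoid.mdifferentiable_tgt : MDifferentiable IE₁ IE₀ 𝔼.tgt :=
  𝔼.smooth_tgt.mdifferentiable (by simp)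

theorem LieGroupoid.tangentMap_src_unit (v : TangentBundle IE₀ E₀) :
    tangentMap IE₁ IE₀ 𝔼.src (tangentMap IE₀ IE₁ 𝔼.unit v) = v := by
  rw [← tangentMap_comp_at v (𝔼.mdifferentiable_src _) (𝔼.smooth_unit.mdifferentiable (by simp) _),
    show 𝔼.src ∘ 𝔼.unit = id from funext 𝔼.isGroupoid.src_unit, tangentMap_id]
  rfl

theorem LieGroupoid.tangentMap_tgt_unit (v : TangentBundle IE₀ E₀) :
    tangentMap IE₁ IE₀ 𝔼.tgt (tangentMap IE₀ IE₁ 𝔼.unit v) = v := by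
  rw [← tangentMap_comp_at v (𝔼.mdifferentiable_tgt _) (𝔼.smooth_unit.mdifferentiable (by simp) _),
    show 𝔼.tgt ∘ 𝔼.unit = id from funext 𝔼.isGroupoid.tgt_unit, tangentMap_id]
  rfl

namespace PrincipalTwoBundle

variable (P : PrincipalTwoBundle C 𝔼 𝕏)

theorem tangentMap_src_tangentAct (v : TangentBundle IE₁ E₁) (k : C.Arrows) :
    tangentMap IE₁ IE₀ 𝔼.src (tangentAct IE₁ P.act₁ v k) =
      tangentAct IE₀ P.act₀ (tangentMap IE₁ IE₀ 𝔼.src v) (C.twoGroup.src k) :=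
  tangentMap_tangentAct P.principal₁.toIsSmoothRightAction P.principal₀.toIsSmoothRightAction
    (θ := C.twoGroup.src) 𝔼.mdifferentiable_src
    (fun e k => P.act_functor.map_src (e, k)) v k

theorem tangentMap_tgt_tangentAct (v : TangentBundle IE₁ E₁) (k : C.Arrows) :
    tangentMap IE₁ IE₀ 𝔼.tgt (tangentAct IE₁ P.act₁ v k) =
      tangentAct IE₀ P.act₀ (tangentMap IE₁ IE₀ 𝔼.tgt v) (C.twoGroup.tgt k) :=
  tangentMap_tangentAct P.principal₁.toIsSmoothRightAction P.principal₀.toIsSmoothRightAction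
    (θ := C.twoGroup.tgt) 𝔼.mdifferentiable_tgt
    (fun e k => P.act_functor.map_tgt (e, k)) v k

/-- With the analogous statement for the target, this is the part of the functoriality of `δ` that
naturality of `κ` needs. It comes from differentiating `s(e k) = s(e) s(k)` at `k = 1`. -/
theorem tangentMap_src_δ₁ (e : E₁) (K : C.LieArrows) :
    tangentMap IE₁ IE₀ 𝔼.src (P.δ₁ (e, K)) = P.δ₀ (𝔼.src e, K.2) := by
  have h := tangentMap_fundamental P.principal₁.toIsSmoothRightAction
    P.principal₀.toIsSmoothRightAction 𝔼.mdifferentiable_src C.mdifferentiable_src rfl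
    (fun e k => P.act_functor.map_src (e, k)) e K
  rw [C.mfderiv_src_one] at h
  exact h

theorem tangentMap_tgt_δ₁ [LieGroup IG ∞ G] (e : E₁) (K : C.LieArrows) :
    tangentMap IE₁ IE₀ 𝔼.tgt (P.δ₁ (e, K)) = P.δ₀ (𝔼.tgt e, C.dτ K.1 + K.2) := by
  have h := tangentMap_fundamental P.principal₁.toIsSmoothRightAction
    P.principal₀.toIsSmoothRightAction 𝔼.mdifferentiable_tgt C.mdifferentiable_tgt
    (show C.τ 1 * 1 = 1 by simp) (fun e k => P.act_functor.map_tgt (e, k)) e K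
  rw [C.mfderiv_tgt_one] at h
  exact h

end PrincipalTwoBundle

/-! ### The modified form is an equivariant one-form -/

namespace PrincipalTwoBundle

variable {P : PrincipalTwoBundle C 𝔼 𝕏} [IsManifold IE₁ ∞ E₁] [IsManifold IE₀ ∞ E₀]
  [IE₁.Boundaryless] [IE₀.Boundaryless]
  {ω₁ : TangentBundle IE₁ E₁ → C.LieArrows} {ω₀ : TangentBundle IE₀ E₀ → LieAlg IG G}
  {lam : TangentBundle IE₀ E₀ → LieAlg IH H}

/-- The added term respects each structure map of `L(𝔾)` separately: `τ(t*λ - s*λ) + τ(s*λ) =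
τ(t*λ)` for targets, and a telescoping sum for composites. -/
theorem IsEquivariantForm.gauge_functor (hω : P.IsEquivariantForm ω₁ ω₀) :
    (𝔼.toGroupoidOps.tangent IE₁ IE₀).IsFunctor C.lieTwoAlgebra
      (fun v => ω₁ v +
        (lam (tangentMap IE₁ IE₀ 𝔼.tgt v) - lam (tangentMap IE₁ IE₀ 𝔼.src v),
          C.dτ (lam (tangentMap IE₁ IE₀ 𝔼.src v))))
      (fun v => ω₀ v + C.dτ (lam v)) where
  map_src v := congrArg (· + C.dτ (lam (tangentMap IE₁ IE₀ 𝔼.src v))) (hω.functor.map_src v)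
  map_tgt v := by
    have h : C.dτ (ω₁ v).1 + (ω₁ v).2 = ω₀ (tangentMap IE₁ IE₀ 𝔼.tgt v) := hω.functor.map_tgt v
    change C.dτ ((ω₁ v).1 + (_ - _)) + ((ω₁ v).2 + _) = _ + _
    rw [C.dτ_add, C.dτ_sub]
    change _ = ω₀ (tangentMap IE₁ IE₀ 𝔼.tgt v) + C.dτ (lam (tangentMap IE₁ IE₀ 𝔼.tgt v))
    rw [← h]
    abel
  map_unit v := by
    have h : ω₁ (tangentMap IE₀ IE₁ 𝔼.unit v) = (0, ω₀ v) := hω.functor.map_unit v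
    change ω₁ (tangentMap IE₀ IE₁ 𝔼.unit v) +
      (lam (tangentMap IE₁ IE₀ 𝔼.tgt (tangentMap IE₀ IE₁ 𝔼.unit v)) -
        lam (tangentMap IE₁ IE₀ 𝔼.src (tangentMap IE₀ IE₁ 𝔼.unit v)),
        C.dτ (lam (tangentMap IE₁ IE₀ 𝔼.src (tangentMap IE₀ IE₁ 𝔼.unit v)))) =
      ((0 : VH), ω₀ v + C.dτ (lam v))
    rw [h, LieGroupoid.tangentMap_src_unit, LieGroupoid.tangentMap_tgt_unit]
    simp
  map_comp b a hab := by
    replace hab : tangentMap IE₁ IE₀ 𝔼.src b = tangentMap IE₁ IE₀ 𝔼.tgt a := hab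
    obtain ⟨hs, ht⟩ := 𝔼.tangentMap_src_and_tgt_comp hab
    have h := hω.functor.map_comp b a hab
    -- With `Ts(b) = Tt(a)` substituted, the two occurrences of `λ` at the intermediate vector
    -- cancel.
    simp only [hs, ht, h, hab]
    simp only [LieCrossedModule.lieTwoAlgebra]
    refine Prod.ext ?_ rfl
    simp only [Prod.fst_add]
    abel

theorem IsEquivariantForm.gauge [LieGroup IG ∞ G] [LieGroup IH ∞ H]
    (hω : P.IsEquivariantForm ω₁ ω₀) (hlam : IsOneForm IE₀ lam)
    (hlam_equivariant : ∀ v g, lam (tangentAct IE₀ P.act₀ v g) = C.dα g⁻¹ (lam v)) :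
    P.IsEquivariantForm
      (fun v => ω₁ v +
        (lam (tangentMap IE₁ IE₀ 𝔼.tgt v) - lam (tangentMap IE₁ IE₀ 𝔼.src v),
          C.dτ (lam (tangentMap IE₁ IE₀ 𝔼.src v))))
      (fun v => ω₀ v + C.dτ (lam v)) where
  oneForm₁ := by
    have hs := hlam.comp_tangentMap 𝔼.smooth_src
    have ht := hlam.comp_tangentMap 𝔼.smooth_tgt
    refine ⟨hω.oneForm₁.smooth.add ((ht.smooth.sub hs.smooth).prodMk_space
      (C.contDiff_dτ.contMDiff.comp hs.smooth)), fun p => ⟨fun v w => ?_, fun c v => ?_⟩⟩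
    · have h₁ := (hω.oneForm₁.linear p).map_add v w
      have h₂ := (hs.linear p).map_add v w
      have h₃ := (ht.linear p).map_add v w
      simp only [h₁, h₂, h₃, C.dτ_add]
      refine Prod.ext ?_ ?_ <;> simp only [Prod.fst_add, Prod.snd_add] <;> abel
    · have h₁ := (hω.oneForm₁.linear p).map_smul c v
      have h₂ := (hs.linear p).map_smul c v
      have h₃ := (ht.linear p).map_smul c v
      simp only [h₁, h₂, h₃, C.dτ_smul, ← smul_sub, smul_add, ← Prod.smul_mk]
  oneForm₀ := by
    refine ⟨hω.oneForm₀.smooth.add (C.contDiff_dτ.contMDiff.comp hlam.smooth),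
      fun p => ⟨fun v w => ?_, fun c v => ?_⟩⟩
    · have h₁ := (hω.oneForm₀.linear p).map_add v w
      have h₂ := (hlam.linear p).map_add v w
      simp only [h₁, h₂, C.dτ_add]
      abel
    · have h₁ := (hω.oneForm₀.linear p).map_smul c v
      have h₂ := (hlam.linear p).map_smul c v
      simp only [h₁, h₂, C.dτ_smul, smul_add]
  functor := hω.gauge_functor
  equivariant₁ v k := by
    rw [hω.equivariant₁, P.tangentMap_src_tangentAct, P.tangentMap_tgt_tangentAct,
      hlam_equivariant, hlam_equivariant, C.adjointArrows_add]
    congr 1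
    set X := lam (tangentMap IE₁ IE₀ 𝔼.tgt v)
    set Y := lam (tangentMap IE₁ IE₀ 𝔼.src v)
    -- Split along the kernels of source and target, so that `X = t*λ` is acted on through `t(k)`
    -- and `Y = s*λ` through `s(k)`.
    have h : ((X - Y, C.dτ Y) : C.LieArrows) = (X, 0) + (-Y, C.dτ Y) := by
      simp [sub_eq_add_neg]
    rw [h, C.adjointArrows_add, C.adjointArrows_inv_fst, C.adjointArrows_inv_neg_dτ]
    simp [sub_eq_add_neg]
  equivariant₀ v g := by
    have h : ∀ A B : LieAlg IG G, adjoint IG g⁻¹ (A + B) = adjoint IG g⁻¹ A + adjoint IG g⁻¹ B :=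
      fun A B => map_add (mfderiv IG IG (fun x : G => g⁻¹ * x * g⁻¹⁻¹) 1) A B
    rw [hω.equivariant₀, hlam_equivariant, h, C.adjoint_dτ]

end PrincipalTwoBundle

end TwoBundle

/-! ### The natural isomorphism to the projection -/

theorem mainTheorem10
    {VG WG G VH WH H VE₁ WE₁ E₁ VE₀ WE₀ E₀ VX₁ WX₁ X₁ VX₀ WX₀ X₀ : Type*}
    -- the Lie groups `G` and `H`
    [NormedAddCommGroup VG] [NormedSpace ℝ VG] [FiniteDimensional ℝ VG] [TopologicalSpace WG]
    {IG : ModelWithCorners ℝ VG WG} [IG.Boundaryless]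
    [TopologicalSpace G] [ChartedSpace WG G] [T2Space G] [SecondCountableTopology G]
    [Group G] [LieGroup IG ∞ G]
    [NormedAddCommGroup VH] [NormedSpace ℝ VH] [FiniteDimensional ℝ VH] [TopologicalSpace WH]
    {IH : ModelWithCorners ℝ VH WH} [IH.Boundaryless]
    [TopologicalSpace H] [ChartedSpace WH H] [T2Space H] [SecondCountableTopology H]
    [Group H] [LieGroup IH ∞ H]
    -- the manifolds `E₁`, `E₀`, `X₁`, `X₀`
    [NormedAddCommGroup VE₁] [NormedSpace ℝ VE₁] [FiniteDimensional ℝ VE₁] [TopologicalSpace WE₁]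
    {IE₁ : ModelWithCorners ℝ VE₁ WE₁} [IE₁.Boundaryless]
    [TopologicalSpace E₁] [ChartedSpace WE₁ E₁] [IsManifold IE₁ ∞ E₁]
    [T2Space E₁] [SecondCountableTopology E₁]
    [NormedAddCommGroup VE₀] [NormedSpace ℝ VE₀] [FiniteDimensional ℝ VE₀] [TopologicalSpace WE₀]
    {IE₀ : ModelWithCorners ℝ VE₀ WE₀} [IE₀.Boundaryless]
    [TopologicalSpace E₀] [ChartedSpace WE₀ E₀] [IsManifold IE₀ ∞ E₀]
    [T2Space E₀] [SecondCountableTopology E₀]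
    [NormedAddCommGroup VX₁] [NormedSpace ℝ VX₁] [FiniteDimensional ℝ VX₁] [TopologicalSpace WX₁]
    {IX₁ : ModelWithCorners ℝ VX₁ WX₁} [IX₁.Boundaryless]
    [TopologicalSpace X₁] [ChartedSpace WX₁ X₁] [IsManifold IX₁ ∞ X₁]
    [T2Space X₁] [SecondCountableTopology X₁]
    [NormedAddCommGroup VX₀] [NormedSpace ℝ VX₀] [FiniteDimensional ℝ VX₀] [TopologicalSpace WX₀]
    {IX₀ : ModelWithCorners ℝ VX₀ WX₀} [IX₀.Boundaryless]
    [TopologicalSpace X₀] [ChartedSpace WX₀ X₀] [IsManifold IX₀ ∞ X₀]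
    [T2Space X₀] [SecondCountableTopology X₀]
    -- the principal 2-bundle
    (C : LieCrossedModule IG G IH H) (𝔼 : LieGroupoid IE₁ E₁ IE₀ E₀)
    (𝕏 : LieGroupoid IX₁ X₁ IX₀ X₀) (P : PrincipalTwoBundle C 𝔼 𝕏)
    -- the strict connection and the `L(H)`-valued one-form
    (ω₁ : TangentBundle IE₁ E₁ → C.LieArrows) (ω₀ : TangentBundle IE₀ E₀ → LieAlg IG G)
    (hω : P.IsStrictConnection ω₁ ω₀)
    (lam : TangentBundle IE₀ E₀ → LieAlg IH H) (hlam : IsOneForm IE₀ lam)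
    (hlam_equivariant : ∀ v g, lam (tangentAct IE₀ P.act₀ v g) = C.dα g⁻¹ (lam v)) :
    P.IsSemiStrictConnection
      (fun v => ω₁ v +
        (lam (tangentMap IE₁ IE₀ 𝔼.tgt v) - lam (tangentMap IE₁ IE₀ 𝔼.src v),
          C.dτ (lam (tangentMap IE₁ IE₀ 𝔼.src v))))
      (fun v => ω₀ v + C.dτ (lam v)) := by
  have hact : IsSmoothRightAction IG IE₀ P.act₀ := P.principal₀.toIsSmoothRightAction
  have hδ : ContMDiff (IE₀.prod 𝓘(ℝ, LieAlg IG G)) 𝓘(ℝ, LieAlg IH H) ∞ (fun c => lam (P.δ₀ c)) :=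
    hlam.smooth.comp hact.contMDiff_fundamental
  refine ⟨hω.toIsEquivariantForm.gauge hlam hlam_equivariant,
    -- The `L(G)` component is forced, being the source `ω̃₀(δ_p B)`. The target must be `B`, so `τ`
    -- of the `L(H)` component must be `-τλ(δ_p B)`; `-λ(δ_p B)` is the evident choice.
    fun c => (-lam (P.δ₀ c), c.2 + C.dτ (lam (P.δ₀ c))), ?_, fun p => ⟨fun A B => ?_,
      fun c B => ?_⟩, fun p B g => ?_, fun c => ?_, fun c => ?_, fun c => ?_⟩
  · exact hδ.neg.prodMk_space (contMDiff_snd.add (C.contDiff_dτ.contMDiff.comp hδ))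
  · have h : lam (P.δ₀ (p, A + B)) = lam (P.δ₀ (p, A)) + lam (P.δ₀ (p, B)) :=
      (IsSmoothRightAction.isLinearMap_comp_fundamental (IG := IG) hlam p).map_add A B
    simp only [h, C.dτ_add]
    refine Prod.ext ?_ ?_ <;> simp only [Prod.fst_add, Prod.snd_add] <;> abel
  · have h : lam (P.δ₀ (p, c • B)) = c • lam (P.δ₀ (p, B)) :=
      (IsSmoothRightAction.isLinearMap_comp_fundamental (IG := IG) hlam p).map_smul c B
    simp only [h, C.dτ_smul, ← smul_neg, ← smul_add, ← Prod.smul_mk]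
  · have h : lam (P.δ₀ (P.act₀ p g, adjoint IG g⁻¹ B)) = C.dα g⁻¹ (lam (P.δ₀ (p, B))) :=
      (congrArg lam (hact.fundamental_act p g B)).trans (hlam_equivariant _ _)
    -- A unit arrow plus a vector tangent to the kernel of the target: the adjoint action of `1_g⁻¹`
    -- is known on each.
    have h' : ((-lam (P.δ₀ (p, B)), B + C.dτ (lam (P.δ₀ (p, B)))) : C.LieArrows) =
        (0, B) + (-lam (P.δ₀ (p, B)), C.dτ (lam (P.δ₀ (p, B)))) := by simp
    simp only [h, h']
    rw [C.adjointArrows_add, C.adjointArrows_unit_inv_snd, C.adjointArrows_inv_neg_dτ]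
    simp [LieCrossedModule.twoGroup, LieCrossedModule.sndG, LieCrossedModule.arrow]
  · simp only [LieCrossedModule.lieTwoAlgebra, hω.comp_δ₀]
  · simp only [LieCrossedModule.lieTwoAlgebra, C.dτ_neg]
    abel
  · obtain ⟨e, K⟩ := c
    -- Both composites have `L(H)` part `K.1 - λ(δ(s e, K.2))`: on the left, `-λ` at the target from
    -- `κ` cancels the `t*λ` term of `ω̃₁`.
    simp only [P.tangentMap_src_δ₁, P.tangentMap_tgt_δ₁, hω.comp_δ₁, LieCrossedModule.lieTwoAlgebra,
      GroupoidOps.prod]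
    refine Prod.ext ?_ ?_ <;> simp only [Prod.fst_add, Prod.snd_add]
    abel
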